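/- Let $\Omega$ be a compact metrizable space with its Borel $\sigma$-algebra, let $d:\Omega\times\Omega\to\mathbb{R}$ be a continuous distortion function, and let $Q$ be a probability measure on $\Omega$. For a Markov kernel $\Psi$ on $\Omega$ and a measure $\mu$ put $\Psi(\mu)=\int\Psi(x,\cdot)\,\mu(dx)$. Call $\Psi$ optimal for $Q$ at distortion level $\delta$ if the joint law $\pi_\Psi(dx,dy)=Q(dx)\Psi(x,dy)$ satisfies $\int d\,d\pi_\Psi\le\delta$ and the mutual information $D(\pi_\Psi\Vert Q\otimes\Psi(Q))$ is minimal among all Markov kernels satisfying this constraint, where $D$ denotes information (Kullback-Leibler) divergence. For $\omega=(\omega_1,\dots,\omega_n)\in\Omega^n$ let $Emp_n(\omega)=\frac1n\sum_{i=1}^n\delta_{\omega_i}$. Then there is a decreasing sequence $r_n>0$ with $r_n\to0$, depending only on $\Omega$, $d$ and $Q$, such that the following holds. Let $(d_n)$ be any decreasing sequence of distortion levels that tends to $0$ so slowly that $d_n\ge r_n$ for all sufficiently large $n$, and for each $n$ let $\Psi_{d_n}$ be any Markov kernel that is optimal for $Q$ at distortion level $d_n$. If $\omega_1,\dots,\omega_n$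 are i.i.d. with law $Q$, then for every $\varepsilon>0$ $$Q^{n}\bigl(D(\Psi_{d_n}(Emp_n(\omega))\,\Vert\,\Psi_{d_n}(Q))\ge\varepsilon\bigr)\to0\quad\text{as }n\to\infty .$$ ("Decreasing" is meant in the weak sense.) -/

import Mathlib

open MeasureTheory ProbabilityTheory Filter Topology
open scoped ENNReal

namespace RateDistortion

variable {Ω : Type*} [MeasurableSpace Ω]

/-- The empirical distribution `(1 / n) ∑ᵢ δ_{ωᵢ}` of a sample `ω` of size `n`. -/
noncomputable def empiricalMeasure {n : ℕ} (ω : Fin n → Ω) : Measure Ω :=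
  (n : ℝ≥0∞)⁻¹ • ∑ i, Measure.dirac (ω i)

/-- The mutual information between a source variable with law `Q` and its reproduction
through the Markov kernel `κ`: the information divergence from the joint law to the product
of its two marginals. -/
noncomputable def mutualInformation (Q : Measure Ω) (κ : Kernel Ω Ω) : ℝ≥0∞ :=
  InformationTheory.klDiv (Q ⊗ₘ κ) (Q.prod (κ ∘ₘ Q))

/-- The expected distortion of the coupling of `Q` given by the Markov kernel `κ`. -/
noncomputable def expectedDistortion (d : Ω × Ω → ℝ) (Q : Measure Ω) (κ : Kernel Ω Ω) : ℝ :=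
  ∫ p, d p ∂(Q ⊗ₘ κ)

/-- The Markov kernel `κ` is optimal for the source `Q` at distortion level `δ`: its coupling
has expected distortion at most `δ`, and its mutual information is the least possible among
all Markov kernels of expected distortion at most `δ`. -/
structure IsOptimalKernel (d : Ω × Ω → ℝ) (Q : Measure Ω) (δ : ℝ) (κ : Kernel Ω Ω) :
    Prop where
  isMarkovKernel : IsMarkovKernel κ
  expectedDistortion_le : expectedDistortion d Q κ ≤ δ
  mutualInformation_le : ∀ κ' : Kernel Ω Ω, IsMarkovKernel κ' →
    expectedDistortion d Q κ' ≤ δ → mutualInformation Q κ ≤ mutualInformation Q κ'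

/-- The rate distortion statistic `D(Ψ(Emp_n(ω)) ‖ Ψ(Q))` of the sample `ω`, for the
smoothing kernel `Ψ` and the null hypothesis `Q`. -/
noncomputable def statistic (Q : Measure Ω) (Ψ : Kernel Ω Ω) {n : ℕ} (ω : Fin n → Ω) : ℝ≥0∞ :=
  InformationTheory.klDiv (Ψ ∘ₘ empiricalMeasure ω) (Ψ ∘ₘ Q)

end RateDistortion

open InformationTheory
open scoped NNReal

namespace RateDistortion

/-! Convexity of the rate distortion trade-off gives an optimal kernel a Lagrange multiplier `s`
(`IsOptimalKernel.exists_multiplier`), bounded by means of any strictly feasible kernel of finite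
mutual information. By the Gibbs variational principle a minimizer of the Lagrangian has density
`exp f` with respect to its output law `ν`, where `f` is `-s * d` minus a normalizing term, so `|f|
≤ 2 * s * B` (`ae_eq_expKernel_of_forall_le`).

The smoothed empirical measure then has as `ν`-density an average of `n` i.i.d. bounded terms of
mean one. Divergence is at most the chi-square distance, whose expectation is a variance of order `1
/ n`, and Markov's inequality concludes (`measure_statistic_ge_le`). The constant is uniform over
distortion levels bounded below by some `δ₀ > 0`; letting `δ₀` tend to zero slowly enough with `n`
produces the sequence `r`. -/

/-! ### Convexity of divergence and of mutual information -/

theorem klDiv_add_le {α : Type*} [MeasurableSpace α] (μ₁ μ₂ ν₁ ν₂ : Measure α)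
    [IsFiniteMeasure μ₁] [IsFiniteMeasure μ₂] [IsFiniteMeasure ν₁] [IsFiniteMeasure ν₂] :
    klDiv (μ₁ + μ₂) (ν₁ + ν₂) ≤ klDiv μ₁ ν₁ + klDiv μ₂ ν₂ := by
  by_cases h₁ : μ₁ ≪ ν₁
  swap; · simp [h₁]
  by_cases h₂ : μ₂ ≪ ν₂
  swap; · simp [h₂]
  set ν := ν₁ + ν₂ with hν
  have hν₁ : ν₁ ≪ ν := Measure.AbsolutelyContinuous.rfl.add_right _
  have hν₂ : ν₂ ≪ ν := by
    rw [hν, add_comm]; exact Measure.AbsolutelyContinuous.rfl.add_right _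
  have hac : μ₁ + μ₂ ≪ ν := (h₁.trans hν₁).add_left (h₂.trans hν₂)
  rw [klDiv_eq_lintegral_klFun_of_ac h₁, klDiv_eq_lintegral_klFun_of_ac h₂,
    klDiv_eq_lintegral_klFun_of_ac hac, ← lintegral_rnDeriv_mul hν₁ (by fun_prop),
    ← lintegral_rnDeriv_mul hν₂ (by fun_prop), ← lintegral_add_left (by fun_prop)]
  refine lintegral_mono_ae ?_
  filter_upwards [Measure.rnDeriv_add μ₁ μ₂ ν, Measure.rnDeriv_mul_rnDeriv (κ := ν) h₁,
    Measure.rnDeriv_mul_rnDeriv (κ := ν) h₂, Measure.rnDeriv_add ν₁ ν₂ ν, Measure.rnDeriv_self ν,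
    Measure.rnDeriv_lt_top ν₁ ν, Measure.rnDeriv_lt_top ν₂ ν, Measure.rnDeriv_lt_top μ₁ ν,
    Measure.rnDeriv_lt_top μ₂ ν] with x hμ hm₁ hm₂ hsum hself hf₁ hf₂ hg₁ hg₂
  simp only [Pi.add_apply, Pi.mul_apply] at hμ hm₁ hm₂ hsum hself
  rw [← hν, hself] at hsum
  rw [hμ, ENNReal.toReal_add hg₁.ne hg₂.ne, ← hm₁, ← hm₂, ENNReal.toReal_mul, ENNReal.toReal_mul]
  have hr : (ν₁.rnDeriv ν x).toReal + (ν₂.rnDeriv ν x).toReal = 1 := by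
    rw [← ENNReal.toReal_add hf₁.ne hf₂.ne, ← hsum, ENNReal.toReal_one]
  -- Joint convexity through the perspective of `klFun`: the densities of `ν₁` and `ν₂` with respect
  -- to their sum serve as convex weights.
  have hk := convexOn_klFun.2
    (Set.mem_Ici.2 (ENNReal.toReal_nonneg (a := μ₁.rnDeriv ν₁ x)))
    (Set.mem_Ici.2 (ENNReal.toReal_nonneg (a := μ₂.rnDeriv ν₂ x)))
    (ENNReal.toReal_nonneg (a := ν₁.rnDeriv ν x)) (ENNReal.toReal_nonneg (a := ν₂.rnDeriv ν x)) hr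
  simp only [smul_eq_mul] at hk
  rw [← ENNReal.ofReal_toReal hf₁.ne, ← ENNReal.ofReal_toReal hf₂.ne,
    ← ENNReal.ofReal_mul ENNReal.toReal_nonneg, ← ENNReal.ofReal_mul ENNReal.toReal_nonneg,
    ← ENNReal.ofReal_add, ENNReal.toReal_ofReal ENNReal.toReal_nonneg,
    ENNReal.toReal_ofReal ENNReal.toReal_nonneg]
  · refine ENNReal.ofReal_le_ofReal (le_of_eq_of_le ?_ hk)
    ring_nf
  all_goals exact mul_nonneg ENNReal.toReal_nonneg (klFun_nonneg ENNReal.toReal_nonneg)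

/-- The mixture `a κ₁ + b κ₂` of two kernels. -/
noncomputable def mixture {α β : Type*} [MeasurableSpace α] [MeasurableSpace β] (a b : ℝ≥0)
    (κ₁ κ₂ : Kernel α β) : Kernel α β where
  toFun x := a • κ₁ x + b • κ₂ x
  measurable' := by
    refine Measure.measurable_of_measurable_coe _ fun s hs => ?_
    simp only [Measure.coe_add, Pi.add_apply]
    exact ((κ₁.measurable_coe hs).const_smul a).add ((κ₂.measurable_coe hs).const_smul b)

section Mixture

variable {α β : Type*} [MeasurableSpace α] [MeasurableSpace β] {a b : ℝ≥0} {κ₁ κ₂ : Kernel α β}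

theorem mixture_apply (x : α) : mixture a b κ₁ κ₂ x = a • κ₁ x + b • κ₂ x := rfl

theorem isMarkovKernel_mixture [IsMarkovKernel κ₁] [IsMarkovKernel κ₂] (hab : a + b = 1) :
    IsMarkovKernel (mixture a b κ₁ κ₂) := by
  refine ⟨fun x => ⟨?_⟩⟩
  simp only [mixture_apply, Measure.add_apply, Measure.smul_apply, measure_univ, ENNReal.smul_def, smul_eq_mul, mul_one]
  exact_mod_cast hab

theorem compProd_mixture (Q : Measure α) [IsFiniteMeasure Q] [IsMarkovKernel κ₁]
    [IsMarkovKernel κ₂] (hab : a + b = 1) :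
    Q ⊗ₘ mixture a b κ₁ κ₂ = a • (Q ⊗ₘ κ₁) + b • (Q ⊗ₘ κ₂) := by
  have := isMarkovKernel_mixture (κ₁ := κ₁) (κ₂ := κ₂) hab
  ext s hs
  simp only [Measure.add_apply, Measure.smul_apply,
    Measure.compProd_apply hs, mixture_apply, ENNReal.smul_def, smul_eq_mul]
  rw [lintegral_add_left ((Kernel.measurable_kernel_prodMk_left hs).const_mul _),
    lintegral_const_mul _ (Kernel.measurable_kernel_prodMk_left hs),
    lintegral_const_mul _ (Kernel.measurable_kernel_prodMk_left hs)]

theorem comp_mixture (Q : Measure α) [IsFiniteMeasure Q] [IsMarkovKernel κ₁]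
    [IsMarkovKernel κ₂] (hab : a + b = 1) :
    mixture a b κ₁ κ₂ ∘ₘ Q = a • (κ₁ ∘ₘ Q) + b • (κ₂ ∘ₘ Q) := by
  have := isMarkovKernel_mixture (κ₁ := κ₁) (κ₂ := κ₂) hab
  simp only [← Measure.snd_compProd, compProd_mixture Q hab, Measure.snd]
  rw [Measure.map_add _ _ measurable_snd]
  simp only [ENNReal.smul_def, Measure.map_smul]

end Mixture

variable {Ω : Type*} [MeasurableSpace Ω]

theorem mutualInformation_mixture_le (Q : Measure Ω) [IsFiniteMeasure Q] {a b : ℝ≥0}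
    {κ₁ κ₂ : Kernel Ω Ω} [IsMarkovKernel κ₁] [IsMarkovKernel κ₂] (hab : a + b = 1) :
    mutualInformation Q (mixture a b κ₁ κ₂) ≤
      a * mutualInformation Q κ₁ + b * mutualInformation Q κ₂ := by
  unfold mutualInformation
  have h : Q.prod (a • (κ₁ ∘ₘ Q) + b • (κ₂ ∘ₘ Q)) =
      a • Q.prod (κ₁ ∘ₘ Q) + b • Q.prod (κ₂ ∘ₘ Q) := by
    rw [Measure.prod_add, Measure.prod_smul_right, Measure.prod_smul_right]
  rw [compProd_mixture Q hab, comp_mixture Q hab, h, ← klDiv_smul_same, ← klDiv_smul_same]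
  exact klDiv_add_le _ _ _ _

theorem klDiv_map_swap {α β : Type*} [MeasurableSpace α] [MeasurableSpace β]
    (μ ν : Measure (α × β)) [IsFiniteMeasure μ] [IsFiniteMeasure ν] :
    klDiv (μ.map Prod.swap) (ν.map Prod.swap) = klDiv μ ν := by
  refine le_antisymm (klDiv_map_le _ _ measurable_swap) ?_
  have h := klDiv_map_le (μ.map Prod.swap) (ν.map Prod.swap) measurable_swap
  simpa only [Measure.map_map measurable_swap measurable_swap, Prod.swap_swap_eq,
    Measure.map_id] using h

/-- The chain rule, applied after a swap so that the output marginal comes first, splits the right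
side into the divergence of the output law from `ν` plus the mutual information. -/
theorem mutualInformation_le_klDiv [StandardBorelSpace Ω] [Nonempty Ω] (Q ν : Measure Ω)
    [IsProbabilityMeasure Q] [IsFiniteMeasure ν] (κ : Kernel Ω Ω) [IsMarkovKernel κ] :
    mutualInformation Q κ ≤ klDiv (Q ⊗ₘ κ) (Q.prod ν) := by
  unfold mutualInformation
  rw [← klDiv_map_swap, ← klDiv_map_swap (Q ⊗ₘ κ), Measure.prod_swap, Measure.prod_swap,
    ← compProd_posterior_eq_map_swap, ← Measure.compProd_const, ← Measure.compProd_const,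
    klDiv_compProd_eq_add (μ := κ ∘ₘ Q) (ν := ν)]
  exact le_add_self

theorem integrable_of_abs_le {α : Type*} [MeasurableSpace α] {f : α → ℝ} (hf : Measurable f)
    {B : ℝ} (hB : ∀ p, |f p| ≤ B) (μ : Measure α) [IsFiniteMeasure μ] : Integrable f μ :=
  Integrable.of_bound hf.aestronglyMeasurable B (Eventually.of_forall hB)

theorem expectedDistortion_mixture {d : Ω × Ω → ℝ} (hd : Measurable d) {B : ℝ}
    (hB : ∀ p, |d p| ≤ B) (Q : Measure Ω) [IsFiniteMeasure Q] {a b : ℝ≥0}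
    {κ₁ κ₂ : Kernel Ω Ω} [IsMarkovKernel κ₁] [IsMarkovKernel κ₂] (hab : a + b = 1) :
    expectedDistortion d Q (mixture a b κ₁ κ₂) =
      a * expectedDistortion d Q κ₁ + b * expectedDistortion d Q κ₂ := by
  unfold expectedDistortion
  rw [compProd_mixture Q hab, integral_add_measure (integrable_of_abs_le hd hB _)
    (integrable_of_abs_le hd hB _), integral_smul_nnreal_measure, integral_smul_nnreal_measure]
  rfl

/-! ### Lagrange multipliers -/

/-- Convexity of the rate distortion trade-off across the level of an optimal kernel. -/
theorem IsOptimalKernel.slope_le {d : Ω × Ω → ℝ} (hd : Measurable d) {B : ℝ}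
    (hB : ∀ p, |d p| ≤ B) {Q : Measure Ω} [IsFiniteMeasure Q] {δ : ℝ} {κ κ₁ κ₂ : Kernel Ω Ω}
    (hκ : IsOptimalKernel d Q δ κ) [IsMarkovKernel κ₁] [IsMarkovKernel κ₂]
    (h₁ : mutualInformation Q κ₁ ≠ ∞) (h₂ : mutualInformation Q κ₂ ≠ ∞)
    (hδ₁ : δ < expectedDistortion d Q κ₁) (hδ₂ : expectedDistortion d Q κ₂ < δ) :
    ((mutualInformation Q κ).toReal - (mutualInformation Q κ₁).toReal) /
        (expectedDistortion d Q κ₁ - δ) ≤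
      ((mutualInformation Q κ₂).toReal - (mutualInformation Q κ).toReal) /
        (δ - expectedDistortion d Q κ₂) := by
  set E₁ := expectedDistortion d Q κ₁
  set E₂ := expectedDistortion d Q κ₂
  have hpos : 0 < E₁ - E₂ := by linarith
  -- These weights make the distortion of the mixture exactly `δ`.
  let a : ℝ≥0 := ⟨(δ - E₂) / (E₁ - E₂), div_nonneg (by linarith) hpos.le⟩
  let b : ℝ≥0 := ⟨(E₁ - δ) / (E₁ - E₂), div_nonneg (by linarith) hpos.le⟩
  have ha : (a : ℝ) = (δ - E₂) / (E₁ - E₂) := rfl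
  have hb : (b : ℝ) = (E₁ - δ) / (E₁ - E₂) := rfl
  have hab : a + b = 1 := by
    apply NNReal.coe_injective
    rw [NNReal.coe_add, ha, hb, NNReal.coe_one]
    field_simp
    ring
  have hle := (hκ.mutualInformation_le _ (isMarkovKernel_mixture (κ₁ := κ₁) (κ₂ := κ₂) hab)
    (by
      rw [expectedDistortion_mixture hd hB Q hab, ha, hb]
      refine le_of_eq ?_
      change (δ - E₂) / (E₁ - E₂) * E₁ + (E₁ - δ) / (E₁ - E₂) * E₂ = δ
      field_simp
      ring)).trans (mutualInformation_mixture_le Q hab)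
  have hle' := ENNReal.toReal_mono (ENNReal.add_ne_top.2
    ⟨ENNReal.mul_ne_top ENNReal.coe_ne_top h₁, ENNReal.mul_ne_top ENNReal.coe_ne_top h₂⟩) hle
  rw [ENNReal.toReal_add (ENNReal.mul_ne_top ENNReal.coe_ne_top h₁)
    (ENNReal.mul_ne_top ENNReal.coe_ne_top h₂), ENNReal.toReal_mul, ENNReal.toReal_mul,
    ENNReal.coe_toReal, ENNReal.coe_toReal, ha, hb, div_mul_eq_mul_div, div_mul_eq_mul_div,
    ← add_div, le_div_iff₀ hpos] at hle'
  rw [div_le_div_iff₀ (by linarith) (by linarith)]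
  linarith

/-- A Lagrange multiplier for the distortion constraint, with a bound in terms of any strictly
feasible kernel of finite mutual information. -/
theorem IsOptimalKernel.exists_multiplier {d : Ω × Ω → ℝ} (hd : Measurable d) {B : ℝ}
    (hB : ∀ p, |d p| ≤ B) {Q : Measure Ω} [IsFiniteMeasure Q] {δ : ℝ} {κ κ₀ : Kernel Ω Ω}
    (hκ : IsOptimalKernel d Q δ κ) [IsMarkovKernel κ₀]
    (h₀ : mutualInformation Q κ₀ ≠ ∞) (hδ₀ : expectedDistortion d Q κ₀ < δ) :
    ∃ s : ℝ, 0 ≤ s ∧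
      s ≤ (mutualInformation Q κ₀).toReal / (δ - expectedDistortion d Q κ₀) ∧
      ∀ κ' : Kernel Ω Ω, IsMarkovKernel κ' → mutualInformation Q κ' ≠ ∞ →
        (mutualInformation Q κ).toReal + s * expectedDistortion d Q κ ≤
          (mutualInformation Q κ').toReal + s * expectedDistortion d Q κ' := by
  set I := fun κ : Kernel Ω Ω => (mutualInformation Q κ).toReal
  set E := fun κ : Kernel Ω Ω => expectedDistortion d Q κ
  have hmono : ∀ κ' : Kernel Ω Ω, IsMarkovKernel κ' → mutualInformation Q κ' ≠ ∞ → E κ' ≤ δ →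
      I κ ≤ I κ' := fun κ' hM hfin hE =>
    ENNReal.toReal_mono hfin (hκ.mutualInformation_le κ' hM hE)
  -- Negated slopes of chords from level `δ` to larger distortions. Chords to smaller distortions
  -- bound them above, so the supremum is a supporting slope; inserting `0` makes the set nonempty
  -- and the multiplier nonnegative.
  let S : Set ℝ := insert 0 {t | ∃ κ' : Kernel Ω Ω, IsMarkovKernel κ' ∧
    mutualInformation Q κ' ≠ ∞ ∧ δ < E κ' ∧ t = (I κ - I κ') / (E κ' - δ)}
  have hbound : ∀ κ₂ : Kernel Ω Ω, IsMarkovKernel κ₂ → mutualInformation Q κ₂ ≠ ∞ → E κ₂ < δ →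
      ∀ t ∈ S, t ≤ (I κ₂ - I κ) / (δ - E κ₂) := by
    intro κ₂ hM hfin hE t ht
    rcases ht with rfl | ⟨κ₁, hM₁, hfin₁, hE₁, rfl⟩
    · exact div_nonneg (sub_nonneg.2 (hmono κ₂ hM hfin hE.le)) (sub_nonneg.2 hE.le)
    · exact hκ.slope_le hd hB hfin₁ hfin hE₁ hE
  have hne : S.Nonempty := ⟨0, Set.mem_insert _ _⟩
  have hbdd : BddAbove S := ⟨_, hbound κ₀ ‹_› h₀ hδ₀⟩
  have hs0 : 0 ≤ sSup S := le_csSup hbdd (Set.mem_insert _ _)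
  refine ⟨sSup S, hs0, ?_, fun κ' hM hfin => ?_⟩
  · refine (csSup_le hne (hbound κ₀ ‹_› h₀ hδ₀)).trans ?_
    have : 0 ≤ I κ := ENNReal.toReal_nonneg
    exact div_le_div_of_nonneg_right (by change I κ₀ - I κ ≤ I κ₀; linarith)
      (sub_nonneg.2 hδ₀.le)
  · change I κ + sSup S * E κ ≤ I κ' + sSup S * E κ'
    have hE : E κ ≤ δ := hκ.expectedDistortion_le
    have hmul : sSup S * E κ ≤ sSup S * δ := mul_le_mul_of_nonneg_left hE hs0
    suffices I κ + sSup S * δ ≤ I κ' + sSup S * E κ' by linarith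
    rcases lt_trichotomy (E κ') δ with h | h | h
    · have := csSup_le hne (hbound κ' hM hfin h)
      rw [le_div_iff₀ (by linarith)] at this
      linarith
    · rw [h]
      linarith [hmono κ' hM hfin h.le]
    · have := le_csSup hbdd (Set.mem_insert_of_mem 0 ⟨κ', hM, hfin, h, rfl⟩)
      rw [div_le_iff₀ (by linarith)] at this
      linarith

/-! ### Exponential kernels and the Gibbs variational principle -/

/-- The kernel with density `exp f` with respect to `ν`. -/
noncomputable def expKernel (ν : Measure Ω) [SFinite ν] (f : Ω × Ω → ℝ) : Kernel Ω Ω :=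
  (Kernel.const Ω ν).withDensity fun x y => ENNReal.ofReal (Real.exp (f (x, y)))

section ExpKernel

variable {ν : Measure Ω} [IsProbabilityMeasure ν] {f : Ω × Ω → ℝ}

theorem expKernel_apply (hf : Measurable f) (x : Ω) :
    expKernel ν f x = ν.withDensity fun y => ENNReal.ofReal (Real.exp (f (x, y))) := by
  rw [expKernel, Kernel.withDensity_apply _ (by fun_prop), Kernel.const_apply]

theorem isMarkovKernel_expKernel (hf : Measurable f) {C : ℝ} (hC : ∀ p, f p ≤ C)
    (h1 : ∀ x, ∫ y, Real.exp (f (x, y)) ∂ν = 1) : IsMarkovKernel (expKernel ν f) := by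
  refine ⟨fun x => ⟨?_⟩⟩
  rw [expKernel_apply hf, withDensity_apply _ .univ, Measure.restrict_univ,
    ← ofReal_integral_eq_lintegral_ofReal, h1, ENNReal.ofReal_one]
  · refine integrable_of_abs_le (B := Real.exp C) (by fun_prop) (fun y => ?_) ν
    rw [abs_of_nonneg (Real.exp_nonneg _)]
    exact Real.exp_le_exp.2 (hC _)
  · exact Eventually.of_forall fun _ => Real.exp_nonneg _

theorem integrable_exp_of_le {α : Type*} [MeasurableSpace α] {f : α → ℝ} (hf : Measurable f)
    {C : ℝ} (hC : ∀ p, f p ≤ C) (μ : Measure α) [IsFiniteMeasure μ] :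
    Integrable (fun p => Real.exp (f p)) μ := by
  refine integrable_of_abs_le (B := Real.exp C) (by fun_prop) (fun y => ?_) μ
  rw [abs_of_nonneg (Real.exp_nonneg _)]
  exact Real.exp_le_exp.2 (hC _)

theorem compProd_expKernel (hf : Measurable f) {C : ℝ} (hC : ∀ p, f p ≤ C)
    (h1 : ∀ x, ∫ y, Real.exp (f (x, y)) ∂ν = 1) (Q : Measure Ω) [IsProbabilityMeasure Q] :
    Q ⊗ₘ expKernel ν f = (Q.prod ν).tilted f := by
  have hM := isMarkovKernel_expKernel hf hC h1
  have hint : ∫ p, Real.exp (f p) ∂(Q.prod ν) = 1 := by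
    rw [integral_prod _ (integrable_exp_of_le hf hC _)]
    simp [h1]
  have : IsSFiniteKernel ((Kernel.const Ω ν).withDensity
      fun x y => ENNReal.ofReal (Real.exp (f (x, y)))) := by
    change IsSFiniteKernel (expKernel ν f)
    infer_instance
  rw [expKernel, Measure.compProd_withDensity (by fun_prop), Measure.compProd_const,
    Measure.tilted]
  simp [hint]

theorem toReal_klDiv_tilted_self {α : Type*} [MeasurableSpace α] {ρ : Measure α}
    [IsProbabilityMeasure ρ] {f : α → ℝ} (hf : Measurable f) {C : ℝ} (hC : ∀ p, |f p| ≤ C)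
    (h1 : ∫ p, Real.exp (f p) ∂ρ = 1) :
    klDiv (ρ.tilted f) ρ ≠ ∞ ∧ (klDiv (ρ.tilted f) ρ).toReal = ∫ p, f p ∂(ρ.tilted f) := by
  have hexp := integrable_exp_of_le hf (fun p => (le_abs_self _).trans (hC p)) ρ
  have := isProbabilityMeasure_tilted hexp
  have hac := tilted_absolutelyContinuous ρ f
  have hllr : llr (ρ.tilted f) ρ =ᵐ[ρ.tilted f] f := by
    refine hac.ae_le ?_
    filter_upwards [log_rnDeriv_tilted_left_self hexp] with p hp
    rw [llr, hp, h1, Real.log_one, sub_zero]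
  refine ⟨klDiv_ne_top hac ((integrable_congr hllr).2 (integrable_of_abs_le hf hC _)), ?_⟩
  rw [toReal_klDiv_of_measure_eq hac (by simp), integral_congr_ae hllr]

/-- Since `klDiv π ρ` equals `klDiv π (ρ.tilted f)` plus `∫ f dπ`, the assumed inequality forces the
divergence from the tilted measure to vanish. -/
theorem eq_tilted_of_toReal_klDiv_le {α : Type*} [MeasurableSpace α] {π ρ : Measure α}
    [IsProbabilityMeasure π] [IsProbabilityMeasure ρ] {f : α → ℝ} (hf : Measurable f) {C : ℝ}
    (hC : ∀ p, |f p| ≤ C) (h1 : ∫ p, Real.exp (f p) ∂ρ = 1) (hfin : klDiv π ρ ≠ ∞)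
    (hle : (klDiv π ρ).toReal ≤ ∫ p, f p ∂π) : π = ρ.tilted f := by
  have hexp := integrable_exp_of_le hf (fun p => (le_abs_self _).trans (hC p)) ρ
  have := isProbabilityMeasure_tilted hexp
  obtain ⟨hac, hint⟩ := klDiv_ne_top_iff.1 hfin
  have hfi := integrable_of_abs_le hf hC π
  have hac' : π ≪ ρ.tilted f := hac.trans (absolutelyContinuous_tilted hexp)
  have hint' := integrable_llr_tilted_right hac hfi hint hexp
  have h := integral_llr_tilted_right hac hfi hexp hint
  rw [h1, Real.log_one, add_zero, ← toReal_klDiv_of_measure_eq hac (by simp),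
    ← toReal_klDiv_of_measure_eq hac' (by simp)] at h
  have h0 : (klDiv π (ρ.tilted f)).toReal = 0 :=
    le_antisymm (by linarith) ENNReal.toReal_nonneg
  rw [ENNReal.toReal_eq_zero_iff, or_iff_left (klDiv_ne_top hac' hint')] at h0
  exact klDiv_eq_zero_iff.1 h0

end ExpKernel

theorem integral_fst_compProd {α β : Type*} [MeasurableSpace α] [MeasurableSpace β]
    (Q : Measure α) [IsProbabilityMeasure Q] (κ : Kernel α β) [IsMarkovKernel κ] {g : α → ℝ}
    (hg : Measurable g) : ∫ p, g p.1 ∂(Q ⊗ₘ κ) = ∫ x, g x ∂Q := by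
  conv_rhs => rw [← Measure.fst_compProd Q κ, Measure.fst]
  rw [integral_map measurable_fst.aemeasurable hg.aestronglyMeasurable]

/-- A minimizer of the Lagrangian has an exponential density with respect to its output law. -/
theorem ae_eq_expKernel_of_forall_le [StandardBorelSpace Ω] [Nonempty Ω] {d : Ω × Ω → ℝ}
    (hd : Measurable d) {B : ℝ} (hB : ∀ p, |d p| ≤ B) {Q : Measure Ω} [IsProbabilityMeasure Q]
    {κ : Kernel Ω Ω} [IsMarkovKernel κ] (hfin : mutualInformation Q κ ≠ ∞) {s : ℝ} (hs : 0 ≤ s)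
    (hmin : ∀ κ' : Kernel Ω Ω, IsMarkovKernel κ' → mutualInformation Q κ' ≠ ∞ →
        (mutualInformation Q κ).toReal + s * expectedDistortion d Q κ ≤
          (mutualInformation Q κ').toReal + s * expectedDistortion d Q κ') :
    ∃ f : Ω × Ω → ℝ, Measurable f ∧ (∀ p, |f p| ≤ 2 * s * B) ∧
      κ =ᵐ[Q] expKernel (κ ∘ₘ Q) f := by
  set ν := κ ∘ₘ Q with hν
  let Z : Ω → ℝ := fun x => ∫ y, Real.exp (-s * d (x, y)) ∂ν
  have hdle : ∀ p, |(-s) * d p| ≤ s * B := fun p => by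
    rw [abs_mul, abs_neg, abs_of_nonneg hs]
    exact mul_le_mul_of_nonneg_left (hB p) hs
  have hint : ∀ x, Integrable (fun y => Real.exp (-s * d (x, y))) ν := fun x =>
    integrable_exp_of_le (f := fun y => -s * d (x, y)) (by fun_prop)
      (fun y => (le_abs_self _).trans (hdle _)) ν
  have hZm : Measurable Z := by
    have : StronglyMeasurable (fun p : Ω × Ω => Real.exp (-s * d p)) :=
      (by fun_prop : Measurable fun p : Ω × Ω => Real.exp (-s * d p)).stronglyMeasurable
    exact this.integral_prod_right'.measurable
  have hZlow : ∀ x, Real.exp (-(s * B)) ≤ Z x := fun x => by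
    have := integral_mono (integrable_const (Real.exp (-(s * B)))) (hint x)
      fun y => Real.exp_le_exp.2 (neg_le_of_abs_le (hdle (x, y)))
    simpa [Z] using this
  have hZup : ∀ x, Z x ≤ Real.exp (s * B) := fun x => by
    have := integral_mono (hint x) (integrable_const (Real.exp (s * B)))
      fun y => Real.exp_le_exp.2 ((le_abs_self _).trans (hdle (x, y)))
    simpa [Z] using this
  have hZpos : ∀ x, 0 < Z x := fun x => (Real.exp_pos _).trans_le (hZlow x)
  have hlog : ∀ x, |Real.log (Z x)| ≤ s * B := fun x => by
    rw [abs_le]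
    exact ⟨(Real.le_log_iff_exp_le (hZpos x)).2 (hZlow x),
      (Real.log_le_iff_le_exp (hZpos x)).2 (hZup x)⟩
  -- Subtracting `log Z` normalizes `exp f (x, ·)` to a probability density for every `x`.
  let f : Ω × Ω → ℝ := fun p => -s * d p - Real.log (Z p.1)
  have hf : Measurable f := by fun_prop
  have hfC : ∀ p, |f p| ≤ 2 * s * B := fun p => by
    have := abs_sub (-s * d p) (Real.log (Z p.1))
    have h1 := hdle p
    have h2 := hlog p.1
    change |-s * d p - Real.log (Z p.1)| ≤ _
    linarith
  have hfC' : ∀ p, f p ≤ 2 * s * B := fun p => (le_abs_self _).trans (hfC p)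
  have h1 : ∀ x, ∫ y, Real.exp (f (x, y)) ∂ν = 1 := fun x => by
    simp only [f, Real.exp_sub, Real.exp_log (hZpos _)]
    rw [integral_div]
    exact div_self (hZpos x).ne'
  have hM := isMarkovKernel_expKernel hf hfC' h1
  have hcomp := compProd_expKernel hf hfC' h1 Q
  have hR : ∫ p, Real.exp (f p) ∂(Q.prod ν) = 1 := by
    rw [integral_prod _ (integrable_exp_of_le hf hfC' _)]
    simp [h1]
  have hsplit : ∀ η : Kernel Ω Ω, IsMarkovKernel η →
      ∫ p, f p ∂(Q ⊗ₘ η) = -s * expectedDistortion d Q η - ∫ x, Real.log (Z x) ∂Q := by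
    intro η hη
    have hlogm : Measurable fun x => Real.log (Z x) := by fun_prop
    simp only [f]
    rw [integral_sub ((integrable_of_abs_le hd hB _).const_mul _)
      (integrable_of_abs_le (by fun_prop) (fun p => hlog p.1) _), integral_const_mul,
      integral_fst_compProd Q η hlogm]
    rfl
  refine ⟨f, hf, hfC, ?_⟩
  refine Kernel.ae_eq_of_compProd_eq ?_
  rw [hcomp]
  obtain ⟨hG, hG'⟩ := toReal_klDiv_tilted_self (ρ := Q.prod ν) hf hfC hR
  rw [← hcomp] at hG hG'
  -- The exponential kernel is the competitor. Its output law need not be `ν`, but its Lagrangian is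
  -- still at most `-∫ log Z dQ`; minimality of `κ` then gives the reverse Gibbs inequality.
  have hle := mutualInformation_le_klDiv Q ν (expKernel ν f)
  have hle' := ENNReal.toReal_mono hG hle
  have hmin' := hmin _ hM (ne_top_of_le_ne_top hG hle)
  refine eq_tilted_of_toReal_klDiv_le hf hfC hR hfin ?_
  change (mutualInformation Q κ).toReal ≤ _
  rw [hsplit κ inferInstance]
  rw [hsplit _ hM] at hG'
  linarith

/-! ### Chi-square and second moment bounds for the statistic -/

theorem klFun_le_sq {x : ℝ} (hx : 0 ≤ x) : klFun x ≤ (x - 1) ^ 2 := by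
  rw [klFun_apply]
  rcases hx.eq_or_lt with rfl | hx
  · simp
  · nlinarith [mul_le_mul_of_nonneg_left (Real.log_le_sub_one_of_pos hx) hx.le]

theorem klDiv_withDensity_le {α : Type*} [MeasurableSpace α] (ν : Measure α) [IsFiniteMeasure ν]
    {h : α → ℝ} (hm : Measurable h) (h0 : ∀ y, 0 ≤ h y)
    [IsFiniteMeasure (ν.withDensity fun y => ENNReal.ofReal (h y))] :
    klDiv (ν.withDensity fun y => ENNReal.ofReal (h y)) ν ≤
      ∫⁻ y, ENNReal.ofReal ((h y - 1) ^ 2) ∂ν := by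
  rw [klDiv_eq_lintegral_klFun_of_ac (withDensity_absolutelyContinuous _ _)]
  refine lintegral_mono_ae ?_
  filter_upwards [Measure.rnDeriv_withDensity ν hm.ennreal_ofReal] with y hy
  rw [hy, ENNReal.toReal_ofReal (h0 y)]
  exact ENNReal.ofReal_le_ofReal (klFun_le_sq (h0 y))

theorem comp_empiricalMeasure_apply {n : ℕ} (κ : Kernel Ω Ω) (ω : Fin n → Ω) {s : Set Ω}
    (hs : MeasurableSet s) :
    (κ ∘ₘ empiricalMeasure ω) s = (n : ℝ≥0∞)⁻¹ * ∑ i, κ (ω i) s := by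
  rw [Measure.bind_apply hs κ.aemeasurable, empiricalMeasure, lintegral_smul_measure,
    lintegral_finsetSum_measure, smul_eq_mul]
  congr 1
  exact Finset.sum_congr rfl fun i _ => lintegral_dirac' _ (κ.measurable_coe hs)

theorem isProbabilityMeasure_comp_empiricalMeasure {n : ℕ} (hn : 0 < n) (κ : Kernel Ω Ω)
    [IsMarkovKernel κ] (ω : Fin n → Ω) : IsProbabilityMeasure (κ ∘ₘ empiricalMeasure ω) := by
  refine ⟨?_⟩
  rw [comp_empiricalMeasure_apply κ ω .univ]
  simp only [measure_univ, Finset.sum_const, Finset.card_univ, Fintype.card_fin, nsmul_eq_mul,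
    mul_one]
  exact ENNReal.inv_mul_cancel (by exact_mod_cast hn.ne') (ENNReal.natCast_ne_top n)

section Tail

variable {Q ν : Measure Ω} [IsProbabilityMeasure Q] [IsProbabilityMeasure ν] {f : Ω × Ω → ℝ}

/-- By Tonelli this integral is the `ν`-density of the output law, which is `ν` itself. It centers
the sample averages at one. -/
theorem integral_exp_eq_one_of_comp_expKernel (hf : Measurable f)
    (hν : expKernel ν f ∘ₘ Q = ν) : ∀ᵐ y ∂ν, ∫ x, Real.exp (f (x, y)) ∂Q = 1 := by
  have hden : ν.withDensity (fun y => ∫⁻ x, ENNReal.ofReal (Real.exp (f (x, y))) ∂Q) =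
      ν.withDensity 1 := by
    rw [withDensity_one]
    conv_rhs => rw [← hν]
    ext s hs
    rw [Measure.bind_apply hs (Kernel.aemeasurable _), withDensity_apply _ hs,
      lintegral_lintegral_swap (by fun_prop)]
    refine lintegral_congr fun x => ?_
    rw [expKernel_apply hf, withDensity_apply _ hs]
  have hm : Measurable fun y => ∫⁻ x, ENNReal.ofReal (Real.exp (f (x, y))) ∂Q :=
    Measurable.lintegral_prod_left' (f := fun p => ENNReal.ofReal (Real.exp (f p))) (by fun_prop)
  have hae := (withDensity_eq_iff_of_sigmaFinite hm.aemeasurable aemeasurable_const).1 hden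
  filter_upwards [hae] with y hy
  rw [integral_eq_lintegral_of_nonneg_ae (Eventually.of_forall fun _ => Real.exp_nonneg _)
    (by fun_prop : Measurable fun x => Real.exp (f (x, y))).aestronglyMeasurable, hy]
  simp

theorem comp_empiricalMeasure_eq_withDensity {n : ℕ} (hn : 0 < n) {κ : Kernel Ω Ω}
    (hf : Measurable f) {ω : Fin n → Ω} (hω : ∀ i, κ (ω i) = expKernel ν f (ω i)) :
    κ ∘ₘ empiricalMeasure ω =
      ν.withDensity fun y => ENNReal.ofReal ((n : ℝ)⁻¹ * ∑ i, Real.exp (f (ω i, y))) := by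
  ext s hs
  rw [comp_empiricalMeasure_apply κ ω hs, withDensity_apply _ hs]
  have : ∀ y, ENNReal.ofReal ((n : ℝ)⁻¹ * ∑ i, Real.exp (f (ω i, y))) =
      (n : ℝ≥0∞)⁻¹ * ∑ i, ENNReal.ofReal (Real.exp (f (ω i, y))) := fun y => by
    rw [ENNReal.ofReal_mul (by positivity), ENNReal.ofReal_inv_of_pos (by exact_mod_cast hn),
      ENNReal.ofReal_natCast, ENNReal.ofReal_sum_of_nonneg fun _ _ => Real.exp_nonneg _]
  simp only [this]
  rw [lintegral_const_mul _ (by fun_prop), lintegral_finsetSum _ (by fun_prop)]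
  congr 1
  refine Finset.sum_congr rfl fun i _ => ?_
  rw [hω, expKernel_apply hf, withDensity_apply _ hs]

/-- The mean square deviation of a sample average of a function bounded by `M`. -/
theorem lintegral_average_sub_one_sq_le {n : ℕ} (hn : 0 < n) {g : Ω → ℝ} (hg : Measurable g)
    {M : ℝ} (hM : ∀ x, |g x| ≤ M) (h1 : ∫ x, g x ∂Q = 1) :
    ∫⁻ ω, ENNReal.ofReal (((n : ℝ)⁻¹ * ∑ i, g (ω i) - 1) ^ 2) ∂(Measure.pi fun _ : Fin n => Q) ≤
      ENNReal.ofReal (M ^ 2 / n) := by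
  have hn' : (0 : ℝ) < n := by exact_mod_cast hn
  set P := Measure.pi fun _ : Fin n => Q
  have hL : MemLp g 2 Q := MemLp.of_bound hg.aestronglyMeasurable M (Eventually.of_forall hM)
  have hLi : ∀ i : Fin n, MemLp (fun ω : Fin n → Ω => g (ω i)) 2 P := fun i =>
    MemLp.of_bound (hg.comp (measurable_pi_apply i)).aestronglyMeasurable M (Eventually.of_forall fun ω => hM _)
  have hmean : ∀ i : Fin n, ∫ ω, g (ω i) ∂P = 1 := fun i => by
    rw [← h1, ← (measurePreserving_eval (fun _ : Fin n => Q) i).map_eq,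
      integral_map (measurable_pi_apply i).aemeasurable hg.aestronglyMeasurable]
  set X : (Fin n → Ω) → ℝ := fun ω => (n : ℝ)⁻¹ * ∑ i, g (ω i) with hX
  have hXL : MemLp X 2 P := (memLp_finsetSum _ fun i _ => hLi i).const_mul _
  have hXmean : ∫ ω, X ω ∂P = 1 := by
    simp only [hX]
    rw [integral_const_mul, integral_finsetSum _ fun i _ => (hLi i).integrable (by norm_num)]
    simp only [hmean, Finset.sum_const, Finset.card_univ, Fintype.card_fin, nsmul_eq_mul, mul_one]
    exact inv_mul_cancel₀ hn'.ne'
  have hvar : ∫ ω, (X ω - 1) ^ 2 ∂P ≤ M ^ 2 / n := by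
    have h := variance_eq_integral (μ := P) hXL.aestronglyMeasurable.aemeasurable
    rw [hXmean] at h
    rw [← h, hX, variance_const_mul]
    have hs := variance_sum_pi (μ := fun _ : Fin n => Q) (X := fun _ => g) fun _ => hL
    have hsum : (∑ i : Fin n, fun ω : Fin n → Ω => g (ω i)) = fun ω => ∑ i, g (ω i) := by
      ext ω; simp
    rw [hsum] at hs
    rw [hs, Finset.sum_const, Finset.card_univ, Fintype.card_fin, nsmul_eq_mul]
    have hv : Var[g; Q] ≤ M ^ 2 := by
      refine (variance_le_expectation_sq hg.aestronglyMeasurable).trans ?_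
      have := integral_mono (μ := Q) hL.integrable_sq (integrable_const (M ^ 2)) fun x =>
        sq_le_sq' (neg_le_of_abs_le (hM x)) (le_of_abs_le (hM x))
      simpa using this
    calc ((n : ℝ)⁻¹) ^ 2 * (n * Var[g; Q]) = Var[g; Q] / n := by field_simp
      _ ≤ M ^ 2 / n := div_le_div_of_nonneg_right hv hn'.le
  rw [← ofReal_integral_eq_lintegral_ofReal]
  · exact ENNReal.ofReal_le_ofReal hvar
  · exact (hXL.sub (memLp_const 1)).integrable_sq
  · exact Eventually.of_forall fun _ => sq_nonneg _

theorem measure_statistic_ge_le {κ : Kernel Ω Ω} [IsMarkovKernel κ] (hf : Measurable f) {C : ℝ}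
    (hC : ∀ p, f p ≤ C) (hν : κ ∘ₘ Q = ν) (hκ : κ =ᵐ[Q] expKernel ν f) {n : ℕ} (hn : 0 < n)
    {ε : ℝ} (hε : 0 < ε) :
    (Measure.pi fun _ : Fin n => Q) {ω | ENNReal.ofReal ε ≤ statistic Q κ ω} ≤
      ENNReal.ofReal (Real.exp C ^ 2 / n) / ENNReal.ofReal ε := by
  set P := Measure.pi fun _ : Fin n => Q
  let A : (Fin n → Ω) → Ω → ℝ := fun ω y => (n : ℝ)⁻¹ * ∑ i, Real.exp (f (ω i, y))
  let H : (Fin n → Ω) → ℝ≥0∞ := fun ω => ∫⁻ y, ENNReal.ofReal ((A ω y - 1) ^ 2) ∂ν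
  have hA : Measurable (Function.uncurry A) := by
    unfold A Function.uncurry
    fun_prop
  have hA2 : Measurable fun p : (Fin n → Ω) × Ω => ENNReal.ofReal ((A p.1 p.2 - 1) ^ 2) :=
    ((hA.sub_const 1).pow_const 2).ennreal_ofReal
  have hgood : ∀ᵐ ω ∂P, ∀ i, κ (ω i) = expKernel ν f (ω i) := ae_all_iff.2 fun i =>
    (Measure.quasiMeasurePreserving_eval (fun _ : Fin n => Q) i).ae hκ
  have hle : ∀ᵐ ω ∂P, statistic Q κ ω ≤ H ω := by
    filter_upwards [hgood] with ω hω
    have hp := isProbabilityMeasure_comp_empiricalMeasure hn κ ω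
    have heq := comp_empiricalMeasure_eq_withDensity hn hf hω
    rw [heq] at hp
    rw [statistic, heq, hν]
    exact klDiv_withDensity_le ν (by fun_prop) fun y => by positivity
  have hone : ∀ᵐ y ∂ν, ∫ x, Real.exp (f (x, y)) ∂Q = 1 :=
    integral_exp_eq_one_of_comp_expKernel hf ((Measure.comp_congr hκ).symm.trans hν)
  have hexp : ∀ p, |Real.exp (f p)| ≤ Real.exp C := fun p => by
    rw [abs_of_nonneg (Real.exp_nonneg _)]
    exact Real.exp_le_exp.2 (hC p)
  have hH : ∫⁻ ω, H ω ∂P ≤ ENNReal.ofReal (Real.exp C ^ 2 / n) := by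
    -- After the exchange, the inner integral at fixed `y` is the variance of a sample average.
    rw [lintegral_lintegral_swap hA2.aemeasurable]
    refine (lintegral_mono_ae (g := fun _ => ENNReal.ofReal (Real.exp C ^ 2 / n)) ?_).trans
      (by simp)
    filter_upwards [hone] with y hy
    exact lintegral_average_sub_one_sq_le hn (g := fun x => Real.exp (f (x, y))) (by fun_prop)
      (fun x => hexp (x, y)) hy
  calc P {ω | ENNReal.ofReal ε ≤ statistic Q κ ω}
      ≤ P {ω | ENNReal.ofReal ε ≤ H ω} :=
        measure_mono_ae (hle.mono fun ω h h' => le_trans h' h)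
    _ ≤ (∫⁻ ω, H ω ∂P) / ENNReal.ofReal ε :=
        meas_ge_le_lintegral_div hA2.lintegral_prod_right'.aemeasurable
          (ENNReal.ofReal_pos.2 hε).ne' ENNReal.ofReal_ne_top
    _ ≤ _ := ENNReal.div_le_div_right hH _

end Tail

/-- Uniform tail bound for the statistics of all kernels that are optimal at distortion levels
at least `δ₀`, given a kernel of finite mutual information and distortion below `δ₀`. -/
theorem exists_forall_measure_statistic_ge_le [StandardBorelSpace Ω] [Nonempty Ω]
    {d : Ω × Ω → ℝ} (hd : Measurable d) {B : ℝ} (hB : ∀ p, |d p| ≤ B) {Q : Measure Ω}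
    [IsProbabilityMeasure Q] {δ₀ : ℝ} {κ₀ : Kernel Ω Ω} [IsMarkovKernel κ₀]
    (h₀ : mutualInformation Q κ₀ ≠ ∞) (hδ₀ : expectedDistortion d Q κ₀ < δ₀) :
    ∃ K : ℝ, ∀ δ, δ₀ ≤ δ → ∀ κ : Kernel Ω Ω, IsOptimalKernel d Q δ κ → ∀ n : ℕ, 0 < n →
      ∀ ε : ℝ, 0 < ε →
        (Measure.pi fun _ : Fin n => Q) {ω | ENNReal.ofReal ε ≤ statistic Q κ ω} ≤
          ENNReal.ofReal (K / n) / ENNReal.ofReal ε := by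
  have hB0 : 0 ≤ B := (abs_nonneg _).trans (hB (Classical.arbitrary _))
  refine ⟨Real.exp (2 * ((mutualInformation Q κ₀).toReal /
    (δ₀ - expectedDistortion d Q κ₀)) * B) ^ 2, fun δ hδ κ hκ n hn ε hε => ?_⟩
  have := hκ.isMarkovKernel
  have hfin : mutualInformation Q κ ≠ ∞ :=
    ne_top_of_le_ne_top h₀ (hκ.mutualInformation_le κ₀ ‹_› (hδ₀.le.trans hδ))
  obtain ⟨s, hs0, hs, hmin⟩ := hκ.exists_multiplier hd hB h₀ (hδ₀.trans_le hδ)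
  obtain ⟨f, hf, hfC, hκf⟩ := ae_eq_expKernel_of_forall_le hd hB hfin hs0 hmin
  -- The multiplier bound decreases in `δ`, so its value at `δ₀` serves every larger level.
  have hs' : s ≤ (mutualInformation Q κ₀).toReal / (δ₀ - expectedDistortion d Q κ₀) :=
    hs.trans (div_le_div_of_nonneg_left ENNReal.toReal_nonneg (by linarith) (by linarith))
  refine measure_statistic_ge_le hf (fun p => (le_abs_self _).trans ((hfC p).trans ?_)) rfl hκf
    hn hε
  gcongr

/-! ### Finite mutual information by quantization -/

theorem klDiv_ne_top_of_le {α : Type*} [MeasurableSpace α] {μ ν : Measure α} [IsFiniteMeasure μ]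
    [IsFiniteMeasure ν] (h : μ ≤ ν) : klDiv μ ν ≠ ∞ := by
  rw [klDiv_eq_lintegral_klFun_of_ac (Measure.absolutelyContinuous_of_le h)]
  refine ne_top_of_le_ne_top (measure_ne_top ν Set.univ) ?_
  rw [← lintegral_one]
  refine lintegral_mono_ae ?_
  filter_upwards [Measure.rnDeriv_le_one_of_le h] with x hx
  have h1 : (μ.rnDeriv ν x).toReal ≤ 1 := by
    simpa using ENNReal.toReal_mono ENNReal.one_ne_top hx
  have h0 : 0 ≤ (μ.rnDeriv ν x).toReal := ENNReal.toReal_nonneg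
  rw [← ENNReal.ofReal_one, klFun_apply]
  refine ENNReal.ofReal_le_ofReal ?_
  linarith [Real.mul_log_nonpos h0 h1]

/-- The range of `φ` is finite, so all output distributions lie below one finite measure, the sum of
Dirac masses on that range; a density at most one has finite divergence. -/
theorem mutualInformation_map_ne_top [StandardBorelSpace Ω] [Nonempty Ω] (Q : Measure Ω)
    [IsProbabilityMeasure Q] (κ : Kernel Ω Ω) [IsMarkovKernel κ] (φ : SimpleFunc Ω Ω) :
    mutualInformation Q (κ.map φ) ≠ ∞ := by
  have := Kernel.IsMarkovKernel.map κ φ.measurable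
  set ν : Measure Ω := ∑ j ∈ φ.range, Measure.dirac j
  have hle : ∀ x, κ.map φ x ≤ ν := fun x => by
    refine Measure.le_iff.2 fun s hs => ?_
    rw [Kernel.map_apply' _ φ.measurable _ hs]
    by_cases h : ∃ y, φ y ∈ s
    · obtain ⟨y, hy⟩ := h
      refine prob_le_one.trans ?_
      simp only [ν, Measure.finsetSum_apply]
      refine le_trans (le_of_eq ?_) (Finset.single_le_sum (f := fun j => Measure.dirac j s)
        (fun _ _ => zero_le) (φ.mem_range_self y))
      simp [Measure.dirac_apply' _ hs, hy]
    · have : φ ⁻¹' s = ∅ := Set.eq_empty_of_forall_notMem fun y hy => h ⟨y, hy⟩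
      simp [this]
  have hle' : Q ⊗ₘ κ.map φ ≤ Q.prod ν := by
    refine Measure.le_iff.2 fun s hs => ?_
    rw [Measure.compProd_apply hs, Measure.prod_apply hs]
    exact lintegral_mono fun x => hle x _
  exact ne_top_of_le_ne_top (klDiv_ne_top_of_le hle') (mutualInformation_le_klDiv Q ν _)

theorem expectedDistortion_map_le {d : Ω × Ω → ℝ} (hd : Measurable d) {B : ℝ}
    (hB : ∀ p, |d p| ≤ B) (Q : Measure Ω) [IsProbabilityMeasure Q] (κ : Kernel Ω Ω)
    [IsMarkovKernel κ] {φ : Ω → Ω} (hφ : Measurable φ) {η : ℝ}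
    (h : ∀ x y, d (x, φ y) ≤ d (x, y) + η) :
    expectedDistortion d Q (κ.map φ) ≤ expectedDistortion d Q κ + η := by
  unfold expectedDistortion
  rw [Measure.compProd_map hφ, integral_map (by fun_prop) hd.aestronglyMeasurable]
  have hi := integrable_of_abs_le hd hB (Q ⊗ₘ κ)
  calc ∫ p, d (Prod.map id φ p) ∂(Q ⊗ₘ κ) ≤ ∫ p, (d p + η) ∂(Q ⊗ₘ κ) :=
        integral_mono (integrable_of_abs_le (by fun_prop) (fun p => hB _) _)
          (hi.add (integrable_const η)) fun p => h p.1 p.2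
    _ = _ := by rw [integral_add hi (integrable_const η)]; simp

/-- Quantization of a compact reproduction alphabet at a small cost in distortion. -/
theorem exists_simpleFunc_distortion_le [TopologicalSpace Ω] [CompactSpace Ω]
    [TopologicalSpace.MetrizableSpace Ω] [BorelSpace Ω] [Nonempty Ω] {d : Ω × Ω → ℝ}
    (hd : Continuous d) {η : ℝ} (hη : 0 < η) :
    ∃ φ : SimpleFunc Ω Ω, ∀ x y, d (x, φ y) ≤ d (x, y) + η := by
  let _ := TopologicalSpace.metrizableSpaceMetric Ω
  obtain ⟨ρ, hρ, hρd⟩ := Metric.uniformContinuous_iff.1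
    (CompactSpace.uniformContinuous_of_continuous hd) η hη
  set e := TopologicalSpace.denseSeq Ω
  have hcov : (Set.univ : Set Ω) ⊆ ⋃ k, Metric.ball (e k) ρ := fun y _ => by
    obtain ⟨k, hk⟩ := (TopologicalSpace.denseRange_denseSeq Ω).exists_dist_lt y hρ
    exact Set.mem_iUnion.2 ⟨k, hk⟩
  obtain ⟨t, ht⟩ := isCompact_univ.elim_finite_subcover _ (fun k => Metric.isOpen_ball) hcov
  obtain ⟨N, hN⟩ := t.bddAbove
  refine ⟨SimpleFunc.nearestPt e N, fun x y => ?_⟩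
  obtain ⟨k, hk, hky⟩ := Set.mem_iUnion₂.1 (ht (Set.mem_univ y))
  have hlt : dist (SimpleFunc.nearestPt e N y) y < ρ := by
    have h := SimpleFunc.edist_nearestPt_le e y (hN hk)
    rw [edist_dist, edist_dist, ENNReal.ofReal_le_ofReal_iff dist_nonneg] at h
    rw [Metric.mem_ball, dist_comm] at hky
    exact h.trans_lt hky
  have := hρd (a := (x, SimpleFunc.nearestPt e N y)) (b := (x, y)) (by
    rw [Prod.dist_eq]; simpa using hlt)
  rw [Real.dist_eq] at this
  linarith [(abs_lt.1 this).2]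

/-! ### Choice of the rate and conclusion -/

/-- A diagonal sequence along which `K` grows slower than linearly. -/
theorem exists_monotone_tendsto_div_zero (K : ℕ → ℝ) :
    ∃ k : ℕ → ℕ, Monotone k ∧ Tendsto k atTop atTop ∧
      Tendsto (fun n : ℕ => K (k n) / n) atTop (𝓝 0) := by
  classical
  let P : ℕ → ℕ → Prop := fun n k => ∀ j ≤ k, K j ^ 2 ≤ n
  let k : ℕ → ℕ := fun n => Nat.findGreatest (P n) n
  have hP : ∀ m, ∀ᶠ n : ℕ in atTop, P n m := fun m => by
    have : ∀ j ∈ Finset.range (m + 1), ∀ᶠ n : ℕ in atTop, K j ^ 2 ≤ n := fun j _ =>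
      tendsto_natCast_atTop_atTop.eventually_ge_atTop _
    filter_upwards [(Filter.eventually_all_finset _).2 this] with n hn j hj
    exact hn j (Finset.mem_range.2 (by omega))
  refine ⟨k, ?_, ?_, ?_⟩
  · intro a b hab
    exact Nat.findGreatest_mono (fun m hm j hj => (hm j hj).trans (by exact_mod_cast hab)) hab
  · refine tendsto_atTop.2 fun m => ?_
    filter_upwards [hP m, eventually_ge_atTop m] with n hn hmn
    exact Nat.le_findGreatest hmn hn
  · have hs : Tendsto (fun n : ℕ => (√(n : ℝ))⁻¹) atTop (𝓝 0) :=
      (Real.tendsto_sqrt_atTop.comp tendsto_natCast_atTop_atTop).inv_tendsto_atTop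
    refine squeeze_zero_norm' ?_ hs
    -- `Nat.findGreatest` defaults to `0`, so `P n 0` is needed to certify its value. The bound `K j
    -- ^ 2 ≤ n` then yields `|K (k n)| / n ≤ 1 / √n`.
    filter_upwards [hP 0, eventually_gt_atTop 0] with n hn hpos
    have hk : K (k n) ^ 2 ≤ n := Nat.findGreatest_spec (P := P n) (Nat.zero_le n) hn _ le_rfl
    have hn0 : (0 : ℝ) < n := by exact_mod_cast hpos
    rw [Real.norm_eq_abs, abs_div, abs_of_pos hn0, ← Real.sqrt_div_self, ← abs_of_pos hn0,
      abs_of_pos hn0]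
    exact div_le_div_of_nonneg_right (Real.abs_le_sqrt hk) hn0.le

end RateDistortion

theorem theorem1 {Ω : Type*} [TopologicalSpace Ω] [CompactSpace Ω]
    [TopologicalSpace.MetrizableSpace Ω] [MeasurableSpace Ω] [BorelSpace Ω]
    (d : Ω × Ω → ℝ) (hd : Continuous d) (Q : Measure Ω) [IsProbabilityMeasure Q] :
    ∃ r : ℕ → ℝ, Antitone r ∧ (∀ n, 0 < r n) ∧ Tendsto r atTop (𝓝 0) ∧
      ∀ level : ℕ → ℝ, Antitone level → Tendsto level atTop (𝓝 0) →
        (∀ᶠ n in atTop, r n ≤ level n) →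
        ∀ Ψ : ℝ → Kernel Ω Ω,
          (∀ n, RateDistortion.IsOptimalKernel d Q (level n) (Ψ (level n))) →
          ∀ ε : ℝ, 0 < ε →
            Tendsto (fun n : ℕ => (Measure.pi fun _ : Fin n => Q)
              {ω : Fin n → Ω |
                ENNReal.ofReal ε ≤ RateDistortion.statistic Q (Ψ (level n)) ω})
              atTop (𝓝 0) := by
  have : Nonempty Ω := nonempty_of_isProbabilityMeasure Q
  have : SecondCountableTopology Ω := by
    let _ := TopologicalSpace.metrizableSpaceMetric Ω
    infer_instance
  have : PolishSpace Ω := by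
    let _ := TopologicalSpace.metrizableSpaceMetric Ω
    infer_instance
  have hdm : Measurable d := hd.measurable
  obtain ⟨B, hB'⟩ := isCompact_univ.exists_bound_of_continuousOn hd.continuousOn
  have hB : ∀ p, |d p| ≤ B := fun p => hB' p (Set.mem_univ p)
  -- The constants must be fixed before the levels and kernels are given, so feasibility enters as a
  -- premise; where it fails, `K = 0` works vacuously.
  have hstep : ∀ k : ℕ, ∃ K : ℝ, (∃ κ₀ : Kernel Ω Ω, IsMarkovKernel κ₀ ∧
      RateDistortion.mutualInformation Q κ₀ ≠ ∞ ∧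
      RateDistortion.expectedDistortion d Q κ₀ < 1 / ((k : ℝ) + 1)) →
      ∀ δ, 1 / ((k : ℝ) + 1) ≤ δ → ∀ κ : Kernel Ω Ω, RateDistortion.IsOptimalKernel d Q δ κ →
        ∀ n : ℕ, 0 < n → ∀ ε : ℝ, 0 < ε →
          (Measure.pi fun _ : Fin n => Q)
            {ω | ENNReal.ofReal ε ≤ RateDistortion.statistic Q κ ω} ≤
          ENNReal.ofReal (K / n) / ENNReal.ofReal ε := by
    intro k
    by_cases h : ∃ κ₀ : Kernel Ω Ω, IsMarkovKernel κ₀ ∧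
      RateDistortion.mutualInformation Q κ₀ ≠ ∞ ∧
      RateDistortion.expectedDistortion d Q κ₀ < 1 / ((k : ℝ) + 1)
    · obtain ⟨κ₀, hM, hfin, hlt⟩ := h
      obtain ⟨K, hK⟩ := RateDistortion.exists_forall_measure_statistic_ge_le hdm hB hfin hlt
      exact ⟨K, fun _ => hK⟩
    · exact ⟨0, fun h' => absurd h' h⟩
  choose K hK using hstep
  obtain ⟨k, hkmono, hktop, hkdiv⟩ := RateDistortion.exists_monotone_tendsto_div_zero K
  refine ⟨fun n => 1 / ((k n : ℝ) + 1), ?_, fun n => by positivity,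
    tendsto_one_div_add_atTop_nhds_zero_nat.comp hktop, ?_⟩
  · intro a b hab
    exact one_div_le_one_div_of_le (by positivity)
      (by have : (k a : ℝ) ≤ k b := by exact_mod_cast hkmono hab
          linarith)
  intro level _ hlevel hr Ψ hΨ ε hε
  -- Optimal kernels at levels tending to zero supply feasibility: half the distortion budget goes
  -- to such a kernel, half to quantizing its output.
  have hfeas : ∀ m : ℕ, ∃ κ₀ : Kernel Ω Ω, IsMarkovKernel κ₀ ∧
      RateDistortion.mutualInformation Q κ₀ ≠ ∞ ∧
      RateDistortion.expectedDistortion d Q κ₀ < 1 / ((m : ℝ) + 1) := by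
    intro m
    have hpos : (0 : ℝ) < 1 / ((m : ℝ) + 1) / 2 := by positivity
    obtain ⟨j, hj⟩ := (hlevel.eventually (gt_mem_nhds hpos)).exists
    obtain ⟨φ, hφ⟩ := RateDistortion.exists_simpleFunc_distortion_le hd hpos
    have := (hΨ j).isMarkovKernel
    refine ⟨(Ψ (level j)).map φ, Kernel.IsMarkovKernel.map _ φ.measurable,
      RateDistortion.mutualInformation_map_ne_top Q _ φ, ?_⟩
    have h1 := RateDistortion.expectedDistortion_map_le hdm hB Q (Ψ (level j)) φ.measurable hφ
    have h2 := (hΨ j).expectedDistortion_le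
    linarith
  have hlim : Tendsto (fun n : ℕ => ENNReal.ofReal (K (k n) / n) / ENNReal.ofReal ε) atTop
      (𝓝 0) := by
    have h := ENNReal.Tendsto.div_const (ENNReal.tendsto_ofReal hkdiv)
      (b := ENNReal.ofReal ε) (Or.inr (ENNReal.ofReal_pos.2 hε).ne')
    simpa using h
  refine tendsto_of_tendsto_of_tendsto_of_le_of_le' tendsto_const_nhds hlim
    (Eventually.of_forall fun _ => zero_le) ?_
  filter_upwards [hr, eventually_gt_atTop 0] with n hn hpos
  exact hK (k n) (hfeas _) _ hn _ (hΨ n) n hpos ε hε
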